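/- **Setting.** Let $\mathbf G=(Q,\Sigma,\delta,q_0,Q_m)$ be a tick-automaton: a finite automaton with partial deterministic transition function $\delta$ over a finite event set $\Sigma=\Sigma_{act}\,\dot\cup\,\{tick\}$, with closed behavior $L(\mathbf G)$ and marked behavior $L_m(\mathbf G)$. Let $\Sigma_{hib},\Sigma_{for}\subseteq\Sigma_{act}$ be the prohibitible and the forcible events, and $\Sigma_{uc}=\Sigma\setminus(\Sigma_{hib}\cup\{tick\})$. Write $\overline K$ for the prefix closure of a language $K$, $Elig_K(s)=\{\sigma: s\sigma\in\overline K\}$ and $Elig_{\mathbf G}(s)=\{\sigma: s\sigma\in L(\mathbf G)\}$. A language $K\subseteq L_m(\mathbf G)$ is *controllable* if for all $s\in\overline K$: $Elig_{\mathbf G}(s)\cap(\Sigma_{uc}\cup\{tick\})\subseteq Elig_K(s)$ if $Elig_K(s)\cap\Sigma_{for}=\emptyset$, and $Elig_{\mathbf G}(s)\cap\Sigma_{uc}\subseteq Elig_K(s)$ otherwise. Let $\{Q_{m,i}\mid i=1,\dots,M\}$ be a cover of $Q_m$ by nonempty subsets, and let $N_1,\dots,N_M$ be positive integers. For $K\subseteq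 L_m(\mathbf G)$ let $K_i=\{s\in K:\delta(q_0,s)\in Q_{m,i}\}$, and for $s\in\overline K$ let $M_{K,i}(s)$ be the set of $t\in\Sigma^*$ with $st\in K_i$ and $st'\notin K_i$ for every proper prefix $t'$ of $t$ (so $M_{K,i}(s)=\{\epsilon\}$ if $s\in K_i$). $K$ is *bounded-time completable* w.r.t. $(Q_{m,i},N_i)$ if for all $s\in\overline K$ the set $M_{K,i}(s)$ is nonempty and each of its elements contains at most $N_i$ ticks. Let $\sup\mathcal{BTC}(K,(Q_{m,i},N_i))$, $\sup\mathcal C(K)$ and $\sup\mathcal{CBTC}(K,\{(Q_{m,i},N_i)\})$ be the unions of all sublanguages of $K$ that are, respectively, bounded-time completable w.r.t. $(Q_{m,i},N_i)$; controllable; controllable and bounded-time completable w.r.t. $(Q_{m,i},N_i)$ for every $i$. **Algorithm 1** (input $K$, $Q_{m,i}$, $N_i$). If $K_i=\emptyset$, output $\emptyset$. Otherwise choose a finite deterministic automaton $(X,\Sigma,\xi,x_0,X_m)$ with marked behavior $K_i$. Starting from $(x_0,0)$, explore pairs $(x,d)$, $0\le d\le N_i$, with a stack and a set of visited pairs. When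 $(x,d)$ is taken from the stack, treat each event $\sigma$ for which $y=\xi(x,\sigma)$ is defined. If $x\in X_m$, add the transition $((x,0),\sigma,(y,0))$. If $x\notin X_m$, let $c=d+1$ if $\sigma=tick$ and $c=d$ otherwise; if $c>N_i$, add nothing; if $c\le N_i$, add $((x,d),\sigma,(y,d'))$, where $d'=0$ if $y\in X_m$ and $d'=c$ otherwise. Push the target of an added transition on the stack if it has not been visited before. When the stack is empty, trim the resulting automaton $\mathbf K'$, with initial state $(x_0,0)$ and marker states $(x,0)$, $x\in X_m$, and output $K\cap L(\mathbf K')$. **Algorithm SC** (input $K\subseteq L_m(\mathbf G)$). Choose a finite deterministic automaton with marked behavior $K$ and form its product with $\mathbf G$. Repeat: trim, then delete every state $(x,q)$ at which, for the set $e$ of events still leading from $(x,q)$ to a retained state, some $\sigma\in\Sigma_{uc}$ with $\delta(q,\sigma)$ defined is not in $e$, or $\delta(q,tick)$ is defined, $tick\notin e$ and $e\cap\Sigma_{for}=\emptyset$. When nothing is deleted any more, output the marked behavior of what remains. **Algorithm 2** (input $K$). Set $K^1=K$. In iteration $j$, start with $K^j$, apply Algorithm 1 successively for $i=1,\dots,M$,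 each time to the result of the previous call, and apply Algorithm SC to the final result to obtain $K^{j+1}$. If $K^{j+1}=K^j$, stop with output $CTK=K^{j+1}$; otherwise continue with iteration $j+1$. **Theorem.** Let $E\subseteq\Sigma^*$ be a specification language such that $K:=E\cap L_m(\mathbf G)$ is regular (i.e. represented by a finite automaton). Then, however the automata representing the languages and the order in which events are processed are chosen, Algorithm 2 with input $K$ terminates after finitely many steps and outputs $$CTK=\sup\mathcal{CBTC}(K,\{(Q_{m,i},N_i)\mid i=1,\dots,M\}),$$ which is itself controllable and bounded-time completable w.r.t. every $(Q_{m,i},N_i)$, hence the largest such sublanguage of $K$. Moreover, in each iteration $K^{j+1}=\sup\mathcal C(NK^j_M)$, where $NK^j_0=K^j$ and $NK^j_i=\sup\mathcal{BTC}(NK^j_{i-1},(Q_{m,i},N_i))$. -/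

import Mathlib

namespace TDES

universe u v

/-- The event set `Σ = Σ_act ⊔ {tick}`: `some a` is the activity event `a`, `none` is `tick`. -/
abbrev Event (A : Type u) : Type u := Option A

/-- The distinguished event `tick`. -/
abbrev tick {A : Type u} : Event A := none

/-- Strings over `Σ`. -/
abbrev Str (A : Type u) : Type u := List (Event A)

/-- The number of `tick`s in a string. -/
def ticks {A : Type u} (s : Str A) : ℕ := s.countP Option.isNone

/-- A `tick`-automaton `(Q, Σ, δ, q₀, Q_m)` with partial deterministic transition function. -/
structure TickAutomaton (A : Type u) (Q : Type v) where
  /-- partial transition function -/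
  δ : Q → Event A → Option Q
  /-- initial state -/
  init : Q
  /-- marker states -/
  marked : Set Q

namespace TickAutomaton

variable {A : Type u} {Q : Type v}

/-- The extension of `δ` to strings. -/
def run (G : TickAutomaton A Q) : Q → Str A → Option Q
  | q, [] => some q
  | q, σ :: s => (G.δ q σ).bind fun q' => G.run q' s

/-- The closed behavior `L(G)`. -/
def closedBehavior (G : TickAutomaton A Q) : Set (Str A) :=
  {s | ∃ q, G.run G.init s = some q}

/-- The strings of the closed behavior that lead to a state in `P`. -/
def behaviorTo (G : TickAutomaton A Q) (P : Set Q) : Set (Str A) :=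
  {s | ∃ q ∈ P, G.run G.init s = some q}

/-- The marked behavior `L_m(G)`. -/
def markedBehavior (G : TickAutomaton A Q) : Set (Str A) := G.behaviorTo G.marked

end TickAutomaton

/-- A plant: a `tick`-automaton with prohibitible and forcible activity events. -/
structure Plant (A : Type u) (Q : Type v) extends TickAutomaton A Q where
  /-- prohibitible events `Σ_hib ⊆ Σ_act` -/
  hib : Set A
  /-- forcible events `Σ_for ⊆ Σ_act` -/
  forc : Set A

section Languages

variable {A : Type u} {Q : Type v}

/-- Prefix closure of a language. -/
def pre (K : Set (Str A)) : Set (Str A) := {s | ∃ t, s ++ t ∈ K}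

/-- Events `σ` such that `s σ` lies in the (prefix-closed) language `L`. -/
def elig (L : Set (Str A)) (s : Str A) : Set (Event A) := {σ | s ++ [σ] ∈ L}

/-- Forcible events as a subset of `Σ`. -/
def Plant.forcible (G : Plant A Q) : Set (Event A) := some '' G.forc

/-- Uncontrollable events: `Σ_uc = Σ \ (Σ_hib ∪ {tick})`. -/
def Plant.uncontrollable (G : Plant A Q) : Set (Event A) := (some '' G.hib ∪ {tick})ᶜ

/-- Controllability of a language `K` with respect to `G`. -/
def Controllable (G : Plant A Q) (K : Set (Str A)) : Prop :=
  ∀ s ∈ pre K,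
    (elig (pre K) s ∩ G.forcible = ∅ →
      elig G.closedBehavior s ∩ (G.uncontrollable ∪ {tick}) ⊆ elig (pre K) s) ∧
    (elig (pre K) s ∩ G.forcible ≠ ∅ →
      elig G.closedBehavior s ∩ G.uncontrollable ⊆ elig (pre K) s)

/-- `K_i = K ∩ L_{m,i}(G)`, where `L_{m,i}(G)` consists of the strings in `L_m(G)` that lead to
`P = Q_{m,i}`. -/
def part (G : Plant A Q) (P : Set Q) (K : Set (Str A)) : Set (Str A) :=
  K ∩ (G.markedBehavior ∩ G.behaviorTo P)

/-- `M_{K,i}(s)`: the strings that lead `s` to `K_i` for the first time. -/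
def firstHits (G : Plant A Q) (P : Set Q) (K : Set (Str A)) (s : Str A) : Set (Str A) :=
  {t | s ++ t ∈ part G P K ∧ ∀ t', t' <+: t → t' ≠ t → s ++ t' ∉ part G P K}

/-- If already `s ∈ K_i`, then `M_{K,i}(s) = {ε}`. -/
theorem firstHits_of_mem (G : Plant A Q) (P : Set Q) (K : Set (Str A)) (s : Str A)
    (hs : s ∈ part G P K) : firstHits G P K s = {[]} := by
  ext t
  constructor
  · rintro ⟨_, h⟩
    by_contra hne
    exact h [] List.nil_prefix (fun h0 => hne h0.symm) (by simpa using hs)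
  · rintro rfl
    exact ⟨by simpa using hs, fun t' h1 h2 => absurd (List.prefix_nil.mp h1) h2⟩

/-- `K` is bounded-time completable with respect to `(P, N) = (Q_{m,i}, N_i)`. -/
def Completable (G : Plant A Q) (P : Set Q) (N : ℕ) (K : Set (Str A)) : Prop :=
  ∀ s ∈ pre K, (firstHits G P K s).Nonempty ∧ ∀ t ∈ firstHits G P K s, ticks t ≤ N

/-- `sup BTC(K, (P, N))`. -/
def supBTC (G : Plant A Q) (P : Set Q) (N : ℕ) (K : Set (Str A)) : Set (Str A) :=
  ⋃₀ {K' | K' ⊆ K ∧ Completable G P N K'}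

/-- `sup C(K)`. -/
def supC (G : Plant A Q) (K : Set (Str A)) : Set (Str A) :=
  ⋃₀ {K' | K' ⊆ K ∧ Controllable G K'}

/-- `CBTC(K, {(Q_{m,i}, N_i)})`: the sublanguages of `K` that are controllable and bounded-time
completable with respect to every `(Q_{m,i}, N_i)`. -/
def CBTC (G : Plant A Q) {M : ℕ} (Qm : Fin M → Set Q) (N : Fin M → ℕ) (K : Set (Str A)) :
    Set (Set (Str A)) :=
  {K' | K' ⊆ K ∧ Controllable G K' ∧ ∀ i, Completable G (Qm i) (N i) K'}

/-- `sup CBTC(K, {(Q_{m,i}, N_i)})`. -/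
def supCBTC (G : Plant A Q) {M : ℕ} (Qm : Fin M → Set Q) (N : Fin M → ℕ) (K : Set (Str A)) :
    Set (Str A) :=
  ⋃₀ CBTC G Qm N K

end Languages

/-! Automata given by a set of transitions, as they are manipulated by the algorithms. -/

/-- An automaton stored as a set of transitions `(p, σ, r)`, an initial and marker states. -/
structure Graph (A : Type u) (S : Type v) where
  /-- transitions -/
  trans : Set (S × Event A × S)
  /-- initial state -/
  init : S
  /-- marker states -/
  marked : Set S

namespace Graph

variable {A : Type u} {S : Type v}

/-- `H.Path p s r`: the string `s` leads from `p` to `r`. -/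
inductive Path (H : Graph A S) : S → Str A → S → Prop
  | nil (p : S) : Path H p [] p
  | cons {p q r : S} {σ : Event A} {s : Str A} :
      (p, σ, q) ∈ H.trans → Path H q s r → Path H p (σ :: s) r

/-- Deletion of all states outside `R`: transitions and marker states are restricted to `R`. -/
def restrict (H : Graph A S) (R : Set S) : Graph A S where
  trans := {τ | τ ∈ H.trans ∧ τ.1 ∈ R ∧ τ.2.2 ∈ R}
  init := H.init
  marked := H.marked ∩ R

/-- The states that are both reachable and coreachable, i.e. those which trimming keeps. -/
def useful (H : Graph A S) : Set S :=
  {p | (∃ s, H.Path H.init s p) ∧ ∃ s, ∃ m ∈ H.marked, H.Path p s m}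

/-- The closed behavior of `H` after deletion of all states outside `R`
(empty if the initial state is deleted). -/
def closedOn (H : Graph A S) (R : Set S) : Set (Str A) :=
  {s | H.init ∈ R ∧ ∃ p, (H.restrict R).Path H.init s p}

/-- The marked behavior of `H` after deletion of all states outside `R`
(empty if the initial state is deleted). -/
def markedOn (H : Graph A S) (R : Set S) : Set (Str A) :=
  {s | H.init ∈ R ∧ ∃ m ∈ H.marked, (H.restrict R).Path H.init s m}

end Graph

/-! The search of Algorithm 1, which computes `sup BTC(K, (Q_{m,i}, N_i))`. -/

section Search

variable {A : Type u} {X : Type v}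

/-- The counter after event `σ` has occurred with counter value `d`: only `tick`s are counted. -/
def advance (d : ℕ) (σ : Event A) : ℕ := if σ.isNone then d + 1 else d

open Classical in
/-- The transitions added when the pair `(x, d)` is processed.
At a marker state `x`, every event `σ` that leads `x` to `y` gives `((x,0), σ, (y,0))`.
Otherwise let `c` be the advanced counter: nothing is added if `c > N`; if `c ≤ N`, the transition
leads to `(y, 0)` when `y` is a marker state and to `(y, c)` when it is not. -/
def newTrans (B : TickAutomaton A X) (N : ℕ) (p : X × ℕ) :
    Set ((X × ℕ) × Event A × (X × ℕ)) :=
  {τ | ∃ σ y, B.δ p.1 σ = some y ∧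
    ((p.1 ∈ B.marked ∧ τ = ((p.1, 0), σ, (y, 0))) ∨
     (p.1 ∉ B.marked ∧ advance p.2 σ ≤ N ∧
       τ = (p, σ, (y, if y ∈ B.marked then 0 else advance p.2 σ))))}

/-- The automaton on pairs `(x, d)` with transition set `ξ`, initial state `(x₀, 0)` and marker
states `(x, 0)`, `x` a marker state of `B`. -/
def counterGraph (B : TickAutomaton A X) (ξ : Set ((X × ℕ) × Event A × (X × ℕ))) :
    Graph A (X × ℕ) where
  trans := ξ
  init := (B.init, 0)
  marked := {p | p.1 ∈ B.marked ∧ p.2 = 0}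

end Search

/-! Algorithm SC, which computes `sup C(K)` on the product of an automaton for `K` with `G`. -/

section SC

variable {A : Type u} {X Q : Type v}

/-- The product of an automaton `B` representing the language with the plant `G`. -/
def product {X : Type*} {Q : Type*} (B : TickAutomaton A X) (G : Plant A Q) :
    Graph A (X × Q) where
  trans := {τ | B.δ τ.1.1 τ.2.1 = some τ.2.2.1 ∧ G.δ τ.1.2 τ.2.1 = some τ.2.2.2}
  init := (B.init, G.init)
  marked := {p | p.1 ∈ B.marked ∧ p.2 ∈ G.marked}

/-- Events leading from `p` to a state in `R`. -/
def Graph.eligIn {S : Type*} (H : Graph A S) (R : Set S) (p : S) : Set (Event A) :=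
  {σ | ∃ r ∈ R, (p, σ, r) ∈ H.trans}

/-- The events that must not be absent at a state with plant component `q`, when exactly the events
in `e` are present there: the uncontrollable ones eligible in `G`, and `tick` if it is eligible in
`G` and no forcible event is present. -/
def LocallyControllable {Q : Type*} (G : Plant A Q) (q : Q) (e : Set (Event A)) : Prop :=
  (e ∩ G.forcible = ∅ → {σ | (G.δ q σ).isSome} ∩ (G.uncontrollable ∪ {tick}) ⊆ e) ∧
  (e ∩ G.forcible ≠ ∅ → {σ | (G.δ q σ).isSome} ∩ G.uncontrollable ⊆ e)

/-- One round on the set `R` of states kept so far: trim, then remove every state at which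
controllability is violated. -/
def scRound {X : Type*} {Q : Type*} (B : TickAutomaton A X) (G : Plant A Q) (R : Set (X × Q)) :
    Set (X × Q) :=
  let T := ((product B G).restrict R).useful ∩ R
  {p | p ∈ T ∧ LocallyControllable G p.2 ((product B G).eligIn T p)}

end SC

/-! The fixpoint algorithm (Algorithm 2) as a transition system on configurations. -/

/-- Configurations. `Kj` is always the language `K^j` of the current iteration. -/
inductive Config (A : Type u) (Q : Type v) (M : ℕ) : Type (max u v)
  /-- start of an iteration -/
  | start (Kj : Set (Str A))
  /-- the indices below `i` have been treated (indices run from `0` to `M - 1`), with result `K` -/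
  | loop (Kj : Set (Str A)) (i : ℕ) (K : Set (Str A))
  /-- inside Algorithm 1 with input `K` and index `i`; `B` represents `K_i`; `ξ` is the set of
  transitions, `F` the set of visited pairs, `ST` the stack -/
  | search (Kj : Set (Str A)) (i : Fin M) (K : Set (Str A)) (n : ℕ) (B : TickAutomaton A (Fin n))
      (ξ : Set ((Fin n × ℕ) × Event A × (Fin n × ℕ))) (F : Set (Fin n × ℕ))
      (ST : List (Fin n × ℕ))
  /-- inside Algorithm SC; `B` represents its input, `R` is the set of states kept so far -/
  | control (Kj : Set (Str A)) (n : ℕ) (B : TickAutomaton A (Fin n)) (R : Set (Fin n × Q))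
  /-- the next language `K'` is to be compared with `K^j` -/
  | test (Kj : Set (Str A)) (K' : Set (Str A))
  /-- the algorithm has stopped with output `CTK` -/
  | done (CTK : Set (Str A))

/-- The steps of the algorithm. They are nondeterministic: the automata that represent the
languages and the order in which the events at a state are processed are arbitrary. -/
inductive Step {A : Type u} {Q : Type v} (G : Plant A Q) {M : ℕ} (Qm : Fin M → Set Q)
    (N : Fin M → ℕ) : Config A Q M → Config A Q M → Prop
  | init (Kj) :
      Step G Qm N (.start Kj) (.loop Kj 0 Kj)
  /-- Algorithm 1 outputs `∅` if `K_i = ∅`. -/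
  | searchEmpty (Kj) (i : Fin M) (K) :
      part G (Qm i) K = ∅ →
      Step G Qm N (.loop Kj i K) (.loop Kj (i + 1) ∅)
  /-- Otherwise Algorithm 1 represents `K_i` by a finite automaton and puts `(x₀, 0)` on the
  stack. -/
  | searchStart (Kj) (i : Fin M) (K) (n : ℕ) (B : TickAutomaton A (Fin n)) :
      part G (Qm i) K ≠ ∅ → B.markedBehavior = part G (Qm i) K →
      Step G Qm N (.loop Kj i K) (.search Kj i K n B ∅ {(B.init, 0)} [(B.init, 0)])
  /-- The top `p` of the stack is removed, the transitions from `p` are added, and the targets not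
  visited before are put on the stack, in any order, and are marked as visited. -/
  | searchPop (Kj) (i : Fin M) (K) (n : ℕ) (B : TickAutomaton A (Fin n)) (ξ F) (p) (ST new) :
      new.Nodup → (∀ r, r ∈ new ↔ r ∉ F ∧ ∃ τ ∈ newTrans B (N i) p, τ.2.2 = r) →
      Step G Qm N (.search Kj i K n B ξ F (p :: ST))
        (.search Kj i K n B (ξ ∪ newTrans B (N i) p) (F ∪ {r | r ∈ new}) (new ++ ST))
  /-- If the stack is empty, the automaton is trimmed, and its closed behavior intersected with `K`
  is the output. -/
  | searchEnd (Kj) (i : Fin M) (K) (n : ℕ) (B : TickAutomaton A (Fin n)) (ξ F) :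
      Step G Qm N (.search Kj i K n B ξ F [])
        (.loop Kj (i + 1) (K ∩ (counterGraph B ξ).closedOn (counterGraph B ξ).useful))
  /-- After the last index, Algorithm SC is started on an automaton that represents the result. -/
  | controlStart (Kj NK) (n : ℕ) (B : TickAutomaton A (Fin n)) :
      B.markedBehavior = NK →
      Step G Qm N (.loop Kj M NK) (.control Kj n B Set.univ)
  | controlRound (Kj) (n : ℕ) (B : TickAutomaton A (Fin n)) (R) :
      scRound B G R ≠ R →
      Step G Qm N (.control Kj n B R) (.control Kj n B (scRound B G R))
  | controlEnd (Kj) (n : ℕ) (B : TickAutomaton A (Fin n)) (R) :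
      scRound B G R = R →
      Step G Qm N (.control Kj n B R) (.test Kj ((product B G).markedOn R))
  | halt (Kj K') :
      K' = Kj → Step G Qm N (.test Kj K') (.done K')
  | again (Kj K') :
      K' ≠ Kj → Step G Qm N (.test Kj K') (.start K')

end TDES

namespace TDES

universe u v

/-! ### Languages: suprema as unions, and the tick counter of a language. -/

section Languages

variable {A : Type u} {Q : Type v}

/-! Controllability and bounded-time completability are preserved by arbitrary unions, so all
suprema are attained. The rest consists of correctness of the two inner algorithms and termination
of the outer loop.

Algorithm 1 is correct because its component `d` is an intrinsic quantity of the string read: away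
from marker states it equals `counter (part G P K)`, the ticks since the last visit to `K_i`. A
completable sublanguage never drives this counter above `N` (`Completable.counter_le`), so the
search follows all its strings; conversely, what survives trimming is completable
(`SearchState.closedOn_eq`). Algorithm SC never deletes a state used by `supC`, and at its fixed
point the remaining behavior is controllable (`markedOn_eq_supC`).

Termination needs a bound that does not depend on the iteration, although new automata are chosen
each time. It comes from one right congruence of finite index fixed for the initial `K`
(`exists_observer`): automaton state, plant state, and the truncated counters with respect to the
initial `K_i`. Each language at which an iteration starts, and each result of an operator, consists
of the strings of `K` all of whose prefixes lie in allowed classes (`Saturated`): enlarging a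
controllable or completable sublanguage to its saturation preserves the property, so a supremum
already contains its saturation. Such a language is determined by the classes its prefix closure
meets; a strict decrease loses a class (`Observer.classCount_lt`).

Both operators keep every member of `CBTC`, so `supCBTC` stays included; when an iteration changes
nothing, the current language is itself in `CBTC`, hence equal to the supremum. -/

theorem subset_pre (K : Set (Str A)) : K ⊆ pre K := fun s hs => ⟨[], by simpa using hs⟩

theorem pre_mono {K L : Set (Str A)} (h : K ⊆ L) : pre K ⊆ pre L :=
  fun _ ⟨t, ht⟩ => ⟨t, h ht⟩

theorem mem_pre_of_prefix {K : Set (Str A)} {u s : Str A} (h : u <+: s) (hs : s ∈ pre K) :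
    u ∈ pre K := by
  obtain ⟨w, rfl⟩ := h
  obtain ⟨t, ht⟩ := hs
  exact ⟨w ++ t, by simpa using ht⟩

theorem ticks_append (s t : Str A) : ticks (s ++ t) = ticks s + ticks t :=
  List.countP_append

theorem advance_eq (d : ℕ) (σ : Event A) : advance d σ = d + ticks [σ] := by
  unfold advance ticks
  cases σ <;> simp

theorem part_mono (G : Plant A Q) (P : Set Q) {K L : Set (Str A)} (h : K ⊆ L) :
    part G P K ⊆ part G P L :=
  fun _ hs => ⟨h hs.1, hs.2⟩

theorem exists_first_hit (P : Set (Str A)) (s t : Str A) (h : s ++ t ∈ P) :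
    ∃ t₀, t₀ <+: t ∧ s ++ t₀ ∈ P ∧ ∀ t', t' <+: t₀ → t' ≠ t₀ → s ++ t' ∉ P := by
  induction hn : t.length using Nat.strong_induction_on generalizing t with
  | _ n ih =>
    by_cases hc : ∃ t', t' <+: t ∧ t' ≠ t ∧ s ++ t' ∈ P
    · obtain ⟨t', h1, h2, h3⟩ := hc
      have hlt : t'.length < n :=
        hn ▸ lt_of_le_of_ne h1.length_le fun hl => h2 (h1.eq_of_length hl)
      obtain ⟨t₀, h4, h5⟩ := ih _ hlt t' h3 rfl
      exact ⟨t₀, h4.trans h1, h5⟩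
    · push Not at hc
      exact ⟨t, List.prefix_rfl, h, hc⟩

theorem firstHits_nonempty {G : Plant A Q} {P : Set Q} {K : Set (Str A)} {s t : Str A}
    (h : s ++ t ∈ part G P K) : (firstHits G P K s).Nonempty := by
  obtain ⟨t₀, -, h1, h2⟩ := exists_first_hit _ s t h
  exact ⟨t₀, h1, h2⟩

theorem Completable.exists_hit {G : Plant A Q} {P : Set Q} {N : ℕ} {K : Set (Str A)}
    (hK : Completable G P N K) {s : Str A} (hs : s ∈ pre K) : ∃ t, s ++ t ∈ part G P K :=
  let ⟨t, ht⟩ := (hK s hs).1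
  ⟨t, ht.1⟩

/-- Since `v ++ w` can be completed and no proper prefix of `w` hits, `w` is an initial piece of
some first hit from `v`, and that hit has at most `N` ticks. -/
theorem Completable.ticks_le {G : Plant A Q} {P : Set Q} {N : ℕ} {K : Set (Str A)}
    (hK : Completable G P N K) {v w : Str A} (hs : v ++ w ∈ pre K)
    (h : ∀ w', w' <+: w → w' ≠ w → v ++ w' ∉ part G P K) : ticks w ≤ N := by
  obtain ⟨y, hy⟩ := hK.exists_hit hs
  rw [List.append_assoc] at hy
  obtain ⟨t₀, h1, h2, h3⟩ := exists_first_hit _ v _ hy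
  have hle := (hK v (mem_pre_of_prefix (List.prefix_append _ _) hs)).2 t₀ ⟨h2, h3⟩
  have hw : w <+: t₀ := by
    rcases List.prefix_or_prefix_of_prefix h1 (List.prefix_append w y) with h4 | h4
    · by_cases h5 : t₀ = w
      · exact h5 ▸ List.prefix_rfl
      · exact absurd h2 (h _ h4 h5)
    · exact h4
  obtain ⟨x, rfl⟩ := hw
  rw [ticks_append] at hle
  omega

theorem Completable.sUnion {G : Plant A Q} {P : Set Q} {N : ℕ} {C : Set (Set (Str A))}
    (h : ∀ K ∈ C, Completable G P N K) : Completable G P N (⋃₀ C) := by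
  rintro s ⟨t, K, hKC, ht⟩
  refine ⟨?_, ?_⟩
  · obtain ⟨y, hy⟩ := (h K hKC).exists_hit (s := s) ⟨t, ht⟩
    exact firstHits_nonempty (part_mono G P (Set.subset_sUnion_of_mem hKC) hy)
  -- A first hit for the union is a first hit for the member `L` containing the completed string,
  -- since an earlier hit of `L` would also be one of the union.
  · rintro y ⟨⟨⟨L, hLC, hy⟩, hy'⟩, hfirst⟩
    exact (h L hLC s ⟨y, hy⟩).2 y ⟨⟨hy, hy'⟩, fun t' h1 h2 h3 =>
      hfirst t' h1 h2 (part_mono G P (Set.subset_sUnion_of_mem hLC) h3)⟩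

/-- Controllability requires a set of events at each string, and is monotone in the events that
are present. -/
theorem control_mono {F U V e e' : Set (Event A)} (hee : e ⊆ e')
    (h : (e ∩ F = ∅ → V ∩ (U ∪ {tick}) ⊆ e) ∧ (e ∩ F ≠ ∅ → V ∩ U ⊆ e)) :
    (e' ∩ F = ∅ → V ∩ (U ∪ {tick}) ⊆ e') ∧ (e' ∩ F ≠ ∅ → V ∩ U ⊆ e') := by
  by_cases he : e ∩ F = ∅
  · have h1 := (h.1 he).trans hee
    exact ⟨fun _ => h1, fun _ => (Set.inter_subset_inter_right _ Set.subset_union_left).trans h1⟩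
  · refine ⟨fun h' => absurd ?_ he, fun _ => (h.2 he).trans hee⟩
    exact Set.subset_empty_iff.mp (h' ▸ Set.inter_subset_inter_left F hee)

theorem Controllable.sUnion {G : Plant A Q} {C : Set (Set (Str A))}
    (h : ∀ K ∈ C, Controllable G K) : Controllable G (⋃₀ C) := by
  rintro s ⟨t, K, hKC, ht⟩
  refine control_mono (e := elig (pre K) s) ?_ (h K hKC s ⟨t, ht⟩)
  exact fun σ hσ => pre_mono (Set.subset_sUnion_of_mem hKC) hσ

theorem supBTC_subset (G : Plant A Q) (P : Set Q) (N : ℕ) (K : Set (Str A)) :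
    supBTC G P N K ⊆ K := Set.sUnion_subset fun _ h => h.1

theorem supC_subset (G : Plant A Q) (K : Set (Str A)) : supC G K ⊆ K :=
  Set.sUnion_subset fun _ h => h.1

theorem completable_supBTC (G : Plant A Q) (P : Set Q) (N : ℕ) (K : Set (Str A)) :
    Completable G P N (supBTC G P N K) := Completable.sUnion fun _ h => h.2

theorem controllable_supC (G : Plant A Q) (K : Set (Str A)) : Controllable G (supC G K) :=
  Controllable.sUnion fun _ h => h.2

theorem subset_supBTC {G : Plant A Q} {P : Set Q} {N : ℕ} {K L : Set (Str A)} (h : L ⊆ K)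
    (hL : Completable G P N L) : L ⊆ supBTC G P N K := Set.subset_sUnion_of_mem ⟨h, hL⟩

theorem subset_supC {G : Plant A Q} {K L : Set (Str A)} (h : L ⊆ K) (hL : Controllable G L) :
    L ⊆ supC G K := Set.subset_sUnion_of_mem ⟨h, hL⟩

theorem isGreatest_supCBTC (G : Plant A Q) {M : ℕ} (Qm : Fin M → Set Q) (N : Fin M → ℕ)
    (K : Set (Str A)) : IsGreatest (CBTC G Qm N K) (supCBTC G Qm N K) :=
  ⟨⟨Set.sUnion_subset fun _ h => h.1, Controllable.sUnion fun _ h => h.2.1,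
    fun i => Completable.sUnion fun _ h => h.2.2 i⟩, fun _ h => Set.subset_sUnion_of_mem h⟩

open Classical in
/-- The number of `tick`s in the reversed string since the last string in `L`; the event directly
after a string in `L` is not counted. -/
noncomputable def counterRev (L : Set (Str A)) : Str A → ℕ
  | [] => 0
  | σ :: r => if r.reverse ∈ L then 0 else advance (counterRev L r) σ

/-- The number of `tick`s in a string since the last string in `L`; the event directly after a
string in `L` is not counted. -/
noncomputable def counter (L : Set (Str A)) (s : Str A) : ℕ := counterRev L s.reverse

theorem counter_concat_of_mem {L : Set (Str A)} {s : Str A} (h : s ∈ L) (σ : Event A) :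
    counter L (s ++ [σ]) = 0 := by
  simp [counter, counterRev, h]

theorem counter_concat_of_notMem {L : Set (Str A)} {s : Str A} (h : s ∉ L) (σ : Event A) :
    counter L (s ++ [σ]) = advance (counter L s) σ := by
  simp [counter, counterRev, h]

theorem counter_append {L : Set (Str A)} {s t : Str A}
    (h : ∀ t', t' <+: t → t' ≠ t → s ++ t' ∉ L) :
    counter L (s ++ t) = counter L s + ticks t := by
  induction t using List.reverseRecOn with
  | nil => simp [ticks]
  | append_singleton t σ ih =>
    rw [← List.append_assoc, counter_concat_of_notMem (h t (List.prefix_append _ _) (by simp)),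
      advance_eq, ih, ticks_append, add_assoc]
    refine fun t' h1 h2 => h t' (h1.trans (List.prefix_append _ _)) ?_
    rintro rfl
    simpa using h1.length_le

/-- The string `v` ends one event after the last proper prefix of `s` in `L`. Starting there
matters: at a string of `L` itself the only first hit is empty, so completability bounds nothing
beyond it. -/
theorem exists_counter_eq (L : Set (Str A)) (s : Str A) :
    ∃ v w, s = v ++ w ∧ ticks w = counter L s ∧ ∀ w', w' <+: w → w' ≠ w → v ++ w' ∉ L := by
  induction s using List.reverseRecOn with
  | nil => exact ⟨[], [], rfl, rfl, fun w' h1 h2 => absurd (List.prefix_nil.mp h1) h2⟩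
  | append_singleton s σ ih =>
    by_cases hs : s ∈ L
    · exact ⟨s ++ [σ], [], by simp, (counter_concat_of_mem hs σ).symm,
        fun w' h1 h2 => absurd (List.prefix_nil.mp h1) h2⟩
    · obtain ⟨v, w, rfl, h1, h2⟩ := ih
      refine ⟨v, w ++ [σ], by simp, ?_, fun w' h3 h4 => ?_⟩
      · rw [counter_concat_of_notMem hs, advance_eq, ticks_append, h1]
      · rcases List.prefix_concat_iff.mp h3 with h5 | h5
        · exact absurd h5 h4
        · by_cases h6 : w' = w
          · exact h6 ▸ hs
          · exact h2 w' h5 h6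

/-- The counter refers to the larger language `K`, which resets at least as often as `L` would; a
stretch without hits of `K_i` has no hits of `L_i` either. -/
theorem Completable.counter_le {G : Plant A Q} {P : Set Q} {N : ℕ} {K L : Set (Str A)}
    (hL : Completable G P N L) (hLK : L ⊆ K) {s : Str A} (hs : s ∈ pre L) :
    counter (part G P K) s ≤ N := by
  obtain ⟨v, w, rfl, h1, h2⟩ := exists_counter_eq (part G P K) s
  exact h1 ▸ hL.ticks_le hs fun w' h3 h4 h5 => h2 w' h3 h4 (part_mono G P hLK h5)

/-- An event either resets the counter or adds an amount independent of its value, so truncation is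
compatible with appending. This is what makes the counters usable in a congruence of finite index.
-/
theorem min_counter_concat {L : Set (Str A)} {s s' : Str A} (n : ℕ) (hm : s ∈ L ↔ s' ∈ L)
    (h : min (counter L s) n = min (counter L s') n) (σ : Event A) :
    min (counter L (s ++ [σ])) n = min (counter L (s' ++ [σ])) n := by
  by_cases hs : s ∈ L
  · rw [counter_concat_of_mem hs, counter_concat_of_mem (hm.mp hs)]
  · rw [counter_concat_of_notMem hs, counter_concat_of_notMem (fun h' => hs (hm.mpr h')),
      advance_eq, advance_eq]
    omega

end Languages

/-! ### Runs of automata and a Myhill–Nerode criterion. -/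

namespace TickAutomaton

variable {A : Type u} {X : Type v}

theorem run_append (B : TickAutomaton A X) (q : X) (s t : Str A) :
    B.run q (s ++ t) = (B.run q s).bind fun r => B.run r t := by
  induction s generalizing q with
  | nil => rfl
  | cons σ s ih =>
    simp only [List.cons_append, run]
    cases B.δ q σ with
    | none => rfl
    | some r => exact ih r

theorem run_singleton (B : TickAutomaton A X) (q : X) (σ : Event A) : B.run q [σ] = B.δ q σ := by
  simp only [run]
  cases B.δ q σ <;> rfl

theorem run_concat (B : TickAutomaton A X) (q : X) (s : Str A) (σ : Event A) :
    B.run q (s ++ [σ]) = (B.run q s).bind fun r => B.δ r σ := by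
  rw [run_append]
  simp only [run_singleton]

theorem run_isSome_of_mem_pre {B : TickAutomaton A X} {s : Str A} (h : s ∈ pre B.markedBehavior) :
    ∃ x, B.run B.init s = some x := by
  obtain ⟨t, x, -, hx⟩ := h
  rw [run_append] at hx
  cases hs : B.run B.init s with
  | none => simp [hs] at hx
  | some y => exact ⟨y, rfl⟩

theorem mem_markedBehavior_iff {B : TickAutomaton A X} {s : Str A} {x : X}
    (h : B.run B.init s = some x) : s ∈ B.markedBehavior ↔ x ∈ B.marked := by
  constructor
  · rintro ⟨y, hy, hs⟩
    rw [h] at hs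
    cases hs
    exact hy
  · exact fun hx => ⟨x, hx, h⟩

/-- A language with finitely many left quotients is the marked behavior of a finite automaton. -/
theorem exists_markedBehavior_eq (L : Set (Str A)) {α : Type*} (f : Str A → α)
    (hf : (Set.range f).Finite)
    (h : ∀ s s', f s = f s' → ∀ t, s ++ t ∈ L → s' ++ t ∈ L) :
    ∃ (n : ℕ) (B : TickAutomaton A (Fin n)), B.markedBehavior = L := by
  have hq : (Set.range (Language.leftQuotient (L : Language (Event A)))).Finite := by
    have hfac : ∀ s s', f s = f s' →
        Language.leftQuotient (L : Language (Event A)) s =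
          Language.leftQuotient (L : Language (Event A)) s' := by
      intro s s' hs
      ext t
      exact ⟨h s s' hs t, h s' s hs.symm t⟩
    refine (hf.image fun a => Language.leftQuotient (L : Language (Event A))
      (Function.invFun f a)).subset ?_
    rintro _ ⟨s, rfl⟩
    exact ⟨f s, ⟨s, rfl⟩, hfac _ _ (Function.invFun_eq ⟨s, rfl⟩)⟩
  obtain ⟨S, _, D, hD⟩ := Language.isRegular_iff_finite_range_leftQuotient.mpr hq
  let e := Fintype.equivFin S
  let B : TickAutomaton A (Fin (Fintype.card S)) :=
    { δ := fun x σ => some (e (D.step (e.symm x) σ))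
      init := e D.start
      marked := {x | e.symm x ∈ D.accept} }
  have hrun : ∀ (s : Str A) (x : S), B.run (e x) s = some (e (D.evalFrom x s)) := by
    intro s
    induction s with
    | nil => exact fun _ => rfl
    | cons σ s ih =>
      intro x
      simp only [run, B, Equiv.symm_apply_apply, Option.bind_some]
      exact ih _
  refine ⟨_, B, ?_⟩
  ext s
  rw [mem_markedBehavior_iff (hrun s D.start)]
  change e.symm (e (D.evalFrom D.start s)) ∈ D.accept ↔ s ∈ L
  rw [Equiv.symm_apply_apply]
  conv_rhs => rw [← hD]
  rfl

end TickAutomaton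

/-! ### Paths, restriction and trimming. -/

namespace Graph

variable {A : Type u} {S : Type v} {H : Graph A S}

theorem path_append_iff {p r : S} {s t : Str A} :
    H.Path p (s ++ t) r ↔ ∃ q, H.Path p s q ∧ H.Path q t r := by
  constructor
  · induction s generalizing p with
    | nil => exact fun h => ⟨p, .nil p, h⟩
    | cons σ s ih =>
      rintro (_ | ⟨h1, h2⟩)
      obtain ⟨q, h3, h4⟩ := ih h2
      exact ⟨q, .cons h1 h3, h4⟩
  · rintro ⟨q, h1, h2⟩
    induction h1 with
    | nil => exact h2
    | cons h3 _ ih => exact .cons h3 (ih h2)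

theorem path_singleton {p r : S} {σ : Event A} (h : (p, σ, r) ∈ H.trans) : H.Path p [σ] r :=
  .cons h (.nil r)

theorem Path.concat {p q r : S} {s : Str A} {σ : Event A} (h : H.Path p s q)
    (h' : (q, σ, r) ∈ H.trans) : H.Path p (s ++ [σ]) r :=
  path_append_iff.mpr ⟨q, h, path_singleton h'⟩

theorem Path.of_restrict {R : Set S} {p r : S} {s : Str A} (h : (H.restrict R).Path p s r) :
    H.Path p s r := by
  induction h with
  | nil => exact .nil _
  | cons h _ ih => exact .cons h.1 ih

theorem Path.mem_of_restrict {R : Set S} {p r : S} {s : Str A} (hp : p ∈ R)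
    (h : (H.restrict R).Path p s r) : r ∈ R := by
  induction h with
  | nil => exact hp
  | cons h _ ih => exact ih h.2.2

theorem Path.restrict_useful {p r : S} {s : Str A} (h : H.Path p s r)
    (hp : ∃ s, H.Path H.init s p) (hr : ∃ s, ∃ m ∈ H.marked, H.Path r s m) :
    p ∈ H.useful ∧ (H.restrict H.useful).Path p s r := by
  induction h with
  | nil => exact ⟨⟨hp, hr⟩, .nil _⟩
  | @cons p q r σ s h1 h2 ih =>
    obtain ⟨t, ht⟩ := hp
    obtain ⟨hq, hpath⟩ := ih ⟨_, ht.concat h1⟩ hr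
    have hpu : p ∈ H.useful := by
      obtain ⟨-, w, m, hm, hw⟩ := hq
      exact ⟨⟨t, ht⟩, _, m, hm, .cons h1 hw⟩
    exact ⟨hpu, .cons ⟨h1, hpu, hq⟩ hpath⟩

theorem mem_closedOn_useful {s : Str A} :
    s ∈ H.closedOn H.useful ↔
      ∃ p, H.Path H.init s p ∧ ∃ t, ∃ m ∈ H.marked, H.Path p t m := by
  constructor
  · rintro ⟨hi, p, hp⟩
    exact ⟨p, hp.of_restrict, (Path.mem_of_restrict hi hp).2⟩
  · rintro ⟨p, hp, hm⟩
    obtain ⟨h1, h2⟩ := hp.restrict_useful ⟨[], .nil _⟩ hm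
    exact ⟨h1, p, h2⟩

theorem mem_closedOn_useful_of_prefix {s t : Str A} (h : s ++ t ∈ H.closedOn H.useful) :
    s ∈ H.closedOn H.useful := by
  obtain ⟨p, hp, w, m, hm, hw⟩ := mem_closedOn_useful.mp h
  obtain ⟨q, h1, h2⟩ := path_append_iff.mp hp
  exact mem_closedOn_useful.mpr ⟨q, h1, t ++ w, m, hm, path_append_iff.mpr ⟨p, h2, hw⟩⟩

end Graph

/-! ### Correctness of Algorithm 1. -/

section Search

variable {A : Type u} {X : Type v}

/-- The pairs that the search can visit. -/
def searchSpace (B : TickAutomaton A X) (N : ℕ) : Set (X × ℕ) :=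
  {p | p.2 ≤ N ∧ (p.1 ∈ B.marked → p.2 = 0)}

theorem finite_searchSpace [Finite X] (B : TickAutomaton A X) (N : ℕ) :
    (searchSpace B N).Finite :=
  (Set.finite_univ.prod (Set.finite_Iic N)).subset fun _ hp => ⟨trivial, hp.1⟩

theorem newTrans_target_mem {B : TickAutomaton A X} {N : ℕ} {p : X × ℕ}
    {τ : (X × ℕ) × Event A × (X × ℕ)} (h : τ ∈ newTrans B N p) :
    τ.2.2 ∈ searchSpace B N := by
  obtain ⟨σ, y, -, ⟨-, rfl⟩ | ⟨-, hc, rfl⟩⟩ := h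
  · exact ⟨Nat.zero_le _, fun _ => rfl⟩
  · by_cases hy : y ∈ B.marked
    · simp [searchSpace, hy]
    · simpa [searchSpace, hy] using hc

/-- The search has visited the pairs in `F`, of which those in `W` still have to be processed, and
has found the transitions `ξ`. -/
structure SearchState (B : TickAutomaton A X) (N : ℕ) (ξ : Set ((X × ℕ) × Event A × (X × ℕ)))
    (F W : Set (X × ℕ)) : Prop where
  init_mem : (B.init, 0) ∈ F
  subset : F ⊆ searchSpace B N
  todo_subset : W ⊆ F
  processed : ∀ p ∈ F, p ∈ W ∨ newTrans B N p ⊆ ξ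
  sound : ∀ τ ∈ ξ, (∃ p ∈ F, τ ∈ newTrans B N p) ∧ τ.2.2 ∈ F

theorem SearchState.initial (B : TickAutomaton A X) (N : ℕ) :
    SearchState B N ∅ {(B.init, 0)} {(B.init, 0)} where
  init_mem := rfl
  subset := by
    rintro _ rfl
    exact ⟨Nat.zero_le _, fun _ => rfl⟩
  todo_subset := subset_rfl
  processed := fun _ h => Or.inl h
  sound := fun _ h => h.elim

theorem SearchState.pop {B : TickAutomaton A X} {N : ℕ}
    {ξ : Set ((X × ℕ) × Event A × (X × ℕ))} {F W W' V : Set (X × ℕ)} {p : X × ℕ}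
    (h : SearchState B N ξ F W) (hp : p ∈ W) (hW : W ⊆ insert p W') (hW' : W' ⊆ W)
    (hV : ∀ r, r ∈ V ↔ r ∉ F ∧ ∃ τ ∈ newTrans B N p, τ.2.2 = r) :
    SearchState B N (ξ ∪ newTrans B N p) (F ∪ V) (V ∪ W') where
  init_mem := Or.inl h.init_mem
  subset := by
    rintro r (hr | hr)
    · exact h.subset hr
    · obtain ⟨-, τ, hτ, rfl⟩ := (hV r).mp hr
      exact newTrans_target_mem hτ
  todo_subset := by
    rintro r (hr | hr)
    · exact Or.inr hr
    · exact Or.inl (h.todo_subset (hW' hr))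
  processed := by
    rintro r (hr | hr)
    · rcases h.processed r hr with h1 | h1
      · rcases hW h1 with rfl | h2
        · exact Or.inr Set.subset_union_right
        · exact Or.inl (Or.inr h2)
      · exact Or.inr (h1.trans Set.subset_union_left)
    · exact Or.inl (Or.inl hr)
  sound := by
    rintro τ (hτ | hτ)
    · obtain ⟨⟨q, hq, h1⟩, h2⟩ := h.sound τ hτ
      exact ⟨⟨q, Or.inl hq, h1⟩, Or.inl h2⟩
    · refine ⟨⟨p, Or.inl (h.todo_subset hp), hτ⟩, ?_⟩
      by_cases hF : τ.2.2 ∈ F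
      · exact Or.inl hF
      · exact Or.inr ((hV _).mpr ⟨hF, τ, hτ, rfl⟩)

theorem SearchState.run_of_path {B : TickAutomaton A X} {N : ℕ}
    {ξ : Set ((X × ℕ) × Event A × (X × ℕ))} {F W : Set (X × ℕ)} (h : SearchState B N ξ F W)
    {p r : X × ℕ} {s : Str A} (hs : (counterGraph B ξ).Path p s r) (hp : p ∈ F) :
    B.run p.1 s = some r.1 ∧ r ∈ F := by
  induction hs with
  | nil => exact ⟨rfl, hp⟩
  | cons h1 _ ih =>
    obtain ⟨⟨q, -, hτ⟩, hF⟩ := h.sound _ h1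
    obtain ⟨h2, h3⟩ := ih hF
    refine ⟨?_, h3⟩
    obtain ⟨σ, y, hy, ⟨-, he⟩ | ⟨-, -, he⟩⟩ := hτ
    all_goals
      simp only [Prod.mk.injEq] at he
      obtain ⟨rfl, rfl, rfl⟩ := he
      simpa [TickAutomaton.run, hy] using h2

theorem SearchState.ticks_le {B : TickAutomaton A X} {N : ℕ}
    {ξ : Set ((X × ℕ) × Event A × (X × ℕ))} {F W : Set (X × ℕ)} (h : SearchState B N ξ F W)
    {p r : X × ℕ} {t : Str A} (ht : (counterGraph B ξ).Path p t r) (hp : p ∈ F)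
    (hun : ∀ t', t' <+: t → t' ≠ t → ∀ x, B.run p.1 t' = some x → x ∉ B.marked) :
    p.2 + ticks t ≤ N := by
  induction ht with
  | nil => simpa [ticks] using (h.subset hp).1
  | @cons p q r σ t h1 _ ih =>
    have hpm : p.1 ∉ B.marked := hun [] List.nil_prefix (by simp) _ rfl
    obtain ⟨⟨p', -, σ', y, hy, h2⟩, hF⟩ := h.sound _ h1
    rcases h2 with ⟨hm, he⟩ | ⟨-, hc, he⟩
    · simp only [Prod.mk.injEq] at he
      obtain ⟨rfl, rfl, rfl⟩ := he
      exact absurd hm hpm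
    · simp only [Prod.mk.injEq] at he
      obtain ⟨rfl, rfl, rfl⟩ := he
      have hcons : ticks (σ :: t) = ticks [σ] + ticks t := ticks_append [σ] t
      rw [advance_eq] at hc
      -- If this is the last event, its target may be marked and the counter reset to `0`, so the
      -- bound must come from the guard of the transition rather than from the target.
      by_cases ht0 : t = []
      · subst ht0
        exact hc
      · have hym : y ∉ B.marked :=
          hun [σ] (by simp) (by simpa using Ne.symm ht0) y (by simp [TickAutomaton.run, hy])
        have h3 := ih hF fun t' h4 h5 x hx => hun (σ :: t') (by simpa using h4)
          (by simpa using h5) x (by simpa [TickAutomaton.run, hy] using hx)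
        simp only [hym, if_false, advance_eq] at h3
        omega

/-- When no pairs are left, the search has computed `sup BTC`. -/
theorem SearchState.closedOn_eq {Q : Type*} {G : Plant A Q} {P : Set Q} {K : Set (Str A)}
    {B : TickAutomaton A X} {N : ℕ} {ξ : Set ((X × ℕ) × Event A × (X × ℕ))} {F : Set (X × ℕ)}
    (h : SearchState B N ξ F ∅) (hB : B.markedBehavior = part G P K) :
    K ∩ (counterGraph B ξ).closedOn (counterGraph B ξ).useful = supBTC G P N K := by
  have mem_part : ∀ {s p}, (counterGraph B ξ).Path (counterGraph B ξ).init s p →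
      (s ∈ part G P K ↔ p.1 ∈ B.marked) := fun hs =>
    hB ▸ TickAutomaton.mem_markedBehavior_iff (h.run_of_path hs h.init_mem).1
  have mem_of_closed : ∀ {s}, s ∈ (counterGraph B ξ).closedOn (counterGraph B ξ).useful →
      s ∈ part G P K →
      s ∈ part G P (K ∩ (counterGraph B ξ).closedOn (counterGraph B ξ).useful) :=
    fun h1 h2 => ⟨⟨h2.1, h1⟩, h2.2⟩
  apply Set.Subset.antisymm
  · refine subset_supBTC Set.inter_subset_left ?_
    rintro s ⟨w, -, hw⟩
    refine ⟨?_, ?_⟩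
    · obtain ⟨p, hp, t, m, hm, ht⟩ :=
        Graph.mem_closedOn_useful.mp (Graph.mem_closedOn_useful_of_prefix hw)
      have hst := Graph.path_append_iff.mpr ⟨p, hp, ht⟩
      exact firstHits_nonempty (mem_of_closed
        (Graph.mem_closedOn_useful.mpr ⟨m, hst, [], m, hm, .nil m⟩) ((mem_part hst).mpr hm.1))
    · rintro t ⟨ht, hfirst⟩
      obtain ⟨r, hr, -⟩ := Graph.mem_closedOn_useful.mp ht.1.2
      obtain ⟨p, hp, hpt⟩ := Graph.path_append_iff.mp hr
      obtain ⟨hrun, hpF⟩ := h.run_of_path hp h.init_mem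
      have hle : p.2 + ticks t ≤ N := by
        -- The closed behavior is prefix closed, so an earlier marker state on the path would give
        -- an earlier hit of the output language, contradicting minimality of `t`.
        refine h.ticks_le hpt hpF fun t' h1 h2 x hx hxm => hfirst t' h1 h2 ?_
        refine mem_of_closed ?_ ?_
        · obtain ⟨w, rfl⟩ := h1
          refine Graph.mem_closedOn_useful_of_prefix (t := w) ?_
          simpa using ht.1.2
        · rw [← hB]
          refine ⟨x, hxm, ?_⟩
          rw [TickAutomaton.run_append]
          have hrun' : B.run B.init s = some p.1 := hrun
          rw [hrun']
          exact hx
      omega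
  · refine Set.sUnion_subset ?_
    rintro L ⟨hLK, hL⟩
    -- Every prefix of the completable language `L` is followed by the search. The counter is
    -- claimed only at unmarked states, since at marker states the search stores `0`.
    have hpre : ∀ s ∈ pre L, ∃ r, (counterGraph B ξ).Path (counterGraph B ξ).init s r ∧
        (r.1 ∉ B.marked → r.2 = counter (part G P K) s) := by
      intro s
      induction s using List.reverseRecOn with
      | nil => exact fun _ => ⟨_, .nil _, fun _ => rfl⟩
      | append_singleton s σ ih =>
        intro hsσ
        obtain ⟨p, hp, hpc⟩ := ih (mem_pre_of_prefix (List.prefix_append _ _) hsσ)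
        obtain ⟨hrun, hpF⟩ := h.run_of_path hp h.init_mem
        have hrun' : B.run B.init s = some p.1 := hrun
        have hnew := (h.processed p hpF).resolve_left (Set.notMem_empty _)
        obtain ⟨y, hy⟩ : ∃ y, B.run B.init (s ++ [σ]) = some y := by
          refine TickAutomaton.run_isSome_of_mem_pre ?_
          obtain ⟨t, ht⟩ := hL.exists_hit hsσ
          exact ⟨t, hB ▸ part_mono G P hLK ht⟩
        rw [TickAutomaton.run_concat, hrun', Option.bind_some] at hy
        by_cases hm : p.1 ∈ B.marked
        · have hp0 : p = (p.1, 0) := Prod.ext rfl ((h.subset hpF).2 hm)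
          have htr : ((p.1, 0), σ, (y, 0)) ∈ (counterGraph B ξ).trans :=
            hnew ⟨σ, y, hy, Or.inl ⟨hm, rfl⟩⟩
          rw [← hp0] at htr
          exact ⟨_, hp.concat htr,
            fun _ => (counter_concat_of_mem ((mem_part hp).mpr hm) σ).symm⟩
        · have hc := counter_concat_of_notMem (fun h' => hm ((mem_part hp).mp h')) σ
          rw [← hpc hm] at hc
          have hle := hL.counter_le hLK hsσ
          rw [hc] at hle
          exact ⟨_, hp.concat (hnew ⟨σ, y, hy, Or.inr ⟨hm, hle, rfl⟩⟩), fun hym => by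
            simpa [show y ∉ B.marked from hym] using hc.symm⟩
    intro s hs
    refine ⟨hLK hs, Graph.mem_closedOn_useful.mpr ?_⟩
    obtain ⟨t, ht⟩ := hL.exists_hit (subset_pre L hs)
    obtain ⟨r, hr, -⟩ := hpre _ (subset_pre L ht.1)
    obtain ⟨p, hp, hpt⟩ := Graph.path_append_iff.mp hr
    have hm := (mem_part hr).mp (part_mono G P hLK ht)
    exact ⟨p, hp, t, r, ⟨hm, (h.subset (h.run_of_path hr h.init_mem).2).2 hm⟩, hpt⟩

end Search

/-! ### Correctness of Algorithm SC. -/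

section SC

variable {A : Type u} {X : Type*} {Q : Type*} {B : TickAutomaton A X} {G : Plant A Q}

theorem run_of_path_product {p r : X × Q} {s : Str A} (h : (product B G).Path p s r) :
    B.run p.1 s = some r.1 ∧ G.run p.2 s = some r.2 := by
  induction h with
  | nil => exact ⟨rfl, rfl⟩
  | cons h _ ih =>
    refine ⟨?_, ?_⟩
    · rw [TickAutomaton.run, show B.δ _ _ = _ from h.1]
      exact ih.1
    · rw [TickAutomaton.run, show G.δ _ _ = _ from h.2]
      exact ih.2

theorem path_product_unique {p r r' : X × Q} {s : Str A} (h : (product B G).Path p s r)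
    (h' : (product B G).Path p s r') : r = r' := by
  obtain ⟨h1, h2⟩ := run_of_path_product h
  obtain ⟨h3, h4⟩ := run_of_path_product h'
  rw [h1] at h3
  rw [h2] at h4
  exact Prod.ext (Option.some.inj h3) (Option.some.inj h4)

theorem elig_closedBehavior {s : Str A} {q : Q} (h : G.run G.init s = some q) :
    elig G.closedBehavior s = {σ | (G.δ q σ).isSome} := by
  ext σ
  change (∃ r, G.run G.init (s ++ [σ]) = some r) ↔ (G.δ q σ).isSome
  rw [TickAutomaton.run_concat, h, Option.bind_some, Option.isSome_iff_exists]

theorem scRound_subset (B : TickAutomaton A X) (G : Plant A Q) (R : Set (X × Q)) :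
    scRound B G R ⊆ R := fun _ h => h.1.2

/-- The states kept so far include those that the strings of `L` pass through. -/
def Retains (B : TickAutomaton A X) (G : Plant A Q) (L : Set (Str A)) (R : Set (X × Q)) : Prop :=
  ∀ s ∈ pre L, ∃ p ∈ R, ((product B G).restrict R).Path (product B G).init s p

/-- The product is deterministic, so the states reached by the successive prefixes are exactly those
on the path; if all lie in `R`, the path survives restriction. -/
theorem Retains.of_path {L : Set (Str A)} {R : Set (X × Q)}
    (h : ∀ s ∈ pre L, ∃ p ∈ R, (product B G).Path (product B G).init s p) : Retains B G L R := by
  intro s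
  induction s using List.reverseRecOn with
  | nil =>
    intro hs
    obtain ⟨p, hp, hpath⟩ := h _ hs
    cases hpath
    exact ⟨_, hp, .nil _⟩
  | append_singleton s σ ih =>
    intro hs
    obtain ⟨p, hp, h1⟩ := ih (mem_pre_of_prefix (List.prefix_append _ _) hs)
    obtain ⟨r, hr, h2⟩ := h _ hs
    obtain ⟨p', h3, h4⟩ := Graph.path_append_iff.mp h2
    obtain rfl := path_product_unique h1.of_restrict h3
    cases h4 with
    | cons h5 h6 =>
      cases h6
      exact ⟨_, hr, h1.concat ⟨h5, hp, hr⟩⟩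

theorem Retains.univ {L : Set (Str A)} (hB : L ⊆ B.markedBehavior)
    (hG : L ⊆ G.markedBehavior) : Retains B G L Set.univ := by
  refine Retains.of_path fun s => ?_
  induction s using List.reverseRecOn with
  | nil => exact fun _ => ⟨_, trivial, .nil _⟩
  | append_singleton s σ ih =>
    intro hs
    obtain ⟨p, -, hp⟩ := ih (mem_pre_of_prefix (List.prefix_append _ _) hs)
    obtain ⟨h1, h2⟩ := run_of_path_product hp
    obtain ⟨x, hx⟩ := TickAutomaton.run_isSome_of_mem_pre (pre_mono hB hs)
    obtain ⟨q, hq⟩ := TickAutomaton.run_isSome_of_mem_pre (pre_mono hG hs)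
    have h1' : B.run B.init s = some p.1 := h1
    have h2' : G.run G.init s = some p.2 := h2
    rw [TickAutomaton.run_concat, h1', Option.bind_some] at hx
    rw [TickAutomaton.run_concat, h2', Option.bind_some] at hq
    exact ⟨(x, q), trivial, hp.concat ⟨hx, hq⟩⟩

theorem marked_of_path {s : Str A} {p : X × Q} (h : (product B G).Path (product B G).init s p) :
    p ∈ (product B G).marked ↔ s ∈ B.markedBehavior ∧ s ∈ G.markedBehavior := by
  obtain ⟨h1, h2⟩ := run_of_path_product h
  rw [TickAutomaton.mem_markedBehavior_iff h1]
  exact and_congr_right' (TickAutomaton.mem_markedBehavior_iff h2).symm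

theorem Retains.useful {L : Set (Str A)} {R : Set (X × Q)} (h : Retains B G L R)
    (hB : L ⊆ B.markedBehavior) (hG : L ⊆ G.markedBehavior) {s : Str A} (hs : s ∈ pre L)
    {p : X × Q} (hp : ((product B G).restrict R).Path (product B G).init s p) :
    p ∈ ((product B G).restrict R).useful := by
  obtain ⟨t, ht⟩ := hs
  obtain ⟨m, hmR, hm⟩ := h _ (subset_pre L ht)
  obtain ⟨p', h1, h2⟩ := Graph.path_append_iff.mp hm
  obtain rfl := path_product_unique hp.of_restrict h1.of_restrict
  exact ⟨⟨s, hp⟩, t, m, ⟨(marked_of_path hm.of_restrict).mpr ⟨hB ht, hG ht⟩, hmR⟩, h2⟩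

/-- The events by which `L` continues after `s` all survive at the state reached by `s`, so
controllability of `L` at `s` yields local controllability there by `control_mono`. -/
theorem Retains.scRound {L : Set (Str A)} {R : Set (X × Q)} (h : Retains B G L R)
    (hB : L ⊆ B.markedBehavior) (hG : L ⊆ G.markedBehavior) (hL : Controllable G L) :
    Retains B G L (scRound B G R) := by
  refine Retains.of_path fun s hs => ?_
  obtain ⟨p, hpR, hp⟩ := h s hs
  refine ⟨p, ⟨⟨h.useful hB hG hs hp, hpR⟩, ?_⟩, hp.of_restrict⟩
  have hc := hL s hs
  rw [elig_closedBehavior (run_of_path_product hp.of_restrict).2] at hc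
  refine control_mono ?_ hc
  intro σ hσ
  obtain ⟨r, hrR, hr⟩ := h _ hσ
  obtain ⟨p', h1, h2⟩ := Graph.path_append_iff.mp hr
  obtain rfl := path_product_unique hp.of_restrict h1.of_restrict
  cases h2 with
  | cons h3 h4 =>
    cases h4
    exact ⟨_, ⟨h.useful hB hG hσ hr, hrR⟩, h3.1⟩

/-- When no further state is deleted, `sup C` has been computed. -/
theorem markedOn_eq_supC {K : Set (Str A)} {R : Set (X × Q)} (hB : B.markedBehavior = K)
    (hG : K ⊆ G.markedBehavior) (hR : Retains B G (supC G K) R) (hfix : scRound B G R = R) :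
    (product B G).markedOn R = supC G K := by
  apply Set.Subset.antisymm
  · have hpath : ∀ {s t}, s ++ t ∈ (product B G).markedOn R →
        ∃ p ∈ R, ((product B G).restrict R).Path (product B G).init s p := by
      rintro s t ⟨hi, m, -, hm⟩
      obtain ⟨p, h1, -⟩ := Graph.path_append_iff.mp hm
      exact ⟨p, Graph.Path.mem_of_restrict hi h1, h1⟩
    refine subset_supC ?_ ?_
    · rintro s ⟨-, m, hm, hs⟩
      exact hB ▸ ((marked_of_path hs.of_restrict).mp hm).1
    · rintro s ⟨t, ht⟩
      obtain ⟨p, hpR, hp⟩ := hpath ht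
      have hp' := hfix.symm ▸ hpR
      rw [elig_closedBehavior (run_of_path_product hp.of_restrict).2]
      refine control_mono ?_ hp'.2
      -- At the fixed point every kept state is coreachable within `R`, so a surviving event extends
      -- to a marked string.
      rintro σ ⟨r, ⟨⟨-, w, m, hm, hw⟩, hrR⟩, hr⟩
      refine ⟨w, ht.1, m, hm.1, ?_⟩
      exact Graph.path_append_iff.mpr ⟨r, hp.concat ⟨hr, hpR, hrR⟩, hw⟩
  · intro s hs
    obtain ⟨p, hpR, hp⟩ := hR s (subset_pre _ hs)
    have hsK := supC_subset G K hs
    refine ⟨?_, p, (marked_of_path hp.of_restrict).mpr ⟨hB ▸ hsK, hG hsK⟩, hp⟩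
    obtain ⟨r, hrR, hr⟩ := hR [] ⟨s, hs⟩
    cases hr
    exact hrR

end SC

/-! ### A fixed congruence of finite index and its saturated languages. -/

section Observer

variable {A : Type u} {Q : Type v} {M : ℕ}

/-- A right congruence of finite index, given by its quotient map `z`, which determines membership
in `K`, the state of the plant and whether the counters exceed their bounds. -/
structure Observer (G : Plant A Q) (Qm : Fin M → Set Q) (N : Fin M → ℕ) (K : Set (Str A))
    {Z : Type*} (z : Str A → Z) : Prop where
  finite : (Set.range z).Finite
  append : ∀ {s s'}, z s = z s' → ∀ t, z (s ++ t) = z (s' ++ t)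
  mem : ∀ {s s'}, z s = z s' → s ∈ K → s' ∈ K
  run : ∀ {s s'}, z s = z s' → G.run G.init s = G.run G.init s'
  counter : ∀ {s s'}, z s = z s' → ∀ i, counter (part G (Qm i) K) s ≤ N i →
    counter (part G (Qm i) K) s' ≤ N i

theorem mem_part_congr {G : Plant A Q} {P : Set Q} {K L : Set (Str A)} {s s' : Str A}
    (hKL : s ∈ K → s' ∈ L) (hG : G.run G.init s = G.run G.init s') (h : s ∈ part G P K) :
    s' ∈ part G P L := by
  obtain ⟨h1, ⟨q, hq, h2⟩, ⟨r, hr, h3⟩⟩ := h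
  exact ⟨hKL h1, ⟨q, hq, hG ▸ h2⟩, ⟨r, hr, hG ▸ h3⟩⟩

theorem exists_observer [Finite Q] (G : Plant A Q) (Qm : Fin M → Set Q) (N : Fin M → ℕ)
    (K : Set (Str A)) (hK : Language.IsRegular (T := Event A) K) :
    ∃ (Z : Type v) (z : Str A → Z), Observer G Qm N K z := by
  obtain ⟨S, _, D, hD⟩ := hK
  have hmem : ∀ {s s' : Str A}, D.eval s = D.eval s' → s ∈ K → s' ∈ K := by
    intro s s' h hs
    rw [← hD] at hs ⊢
    change D.eval s' ∈ D.accept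
    exact h ▸ hs
  -- Truncating at `N i + 1` rather than `N i` keeps values within the bound distinguishable from
  -- those above it.
  refine ⟨S × Option Q × (Fin M → ℕ), fun s => (D.eval s, G.run G.init s,
    fun i => min (counter (part G (Qm i) K) s) (N i + 1)), ?_, ?_, ?_, ?_, ?_⟩
  · refine (Set.finite_univ.prod (Set.finite_univ.prod
      (Set.Finite.pi fun i => Set.finite_Iic (N i + 1)))).subset ?_
    rintro _ ⟨s, rfl⟩
    exact ⟨trivial, trivial, fun i _ => Set.mem_Iic.mpr (min_le_right _ _)⟩
  · intro s s' h t
    induction t using List.reverseRecOn with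
    | nil => simpa using h
    | append_singleton t σ ih =>
      simp only [Prod.mk.injEq, funext_iff] at ih ⊢
      obtain ⟨h1, h2, h3⟩ := ih
      simp only [← List.append_assoc]
      refine ⟨?_, ?_, fun i => min_counter_concat _ ⟨?_, ?_⟩ (h3 i) σ⟩
      · rw [DFA.eval_append_singleton, DFA.eval_append_singleton, h1]
      · rw [TickAutomaton.run_concat, TickAutomaton.run_concat, h2]
      · exact mem_part_congr (hmem h1) h2
      · exact mem_part_congr (hmem h1.symm) h2.symm
  · intro s s' h
    simp only [Prod.mk.injEq] at h
    exact hmem h.1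
  · intro s s' h
    simp only [Prod.mk.injEq] at h
    exact h.2.1
  · intro s s' h i
    simp only [Prod.mk.injEq, funext_iff] at h
    have := h.2.2 i
    omega

/-- The strings of `K` all of whose prefixes are equivalent to prefixes of strings in `L`. -/
def saturation {Z : Type*} (z : Str A → Z) (K L : Set (Str A)) : Set (Str A) :=
  {s | s ∈ K ∧ ∀ u, u <+: s → ∃ u' ∈ pre L, z u = z u'}

/-- `L` arises from `K` by forbidding the passage through certain classes. -/
def Saturated {Z : Type*} (z : Str A → Z) (K L : Set (Str A)) : Prop :=
  L ⊆ K ∧ saturation z K L ⊆ L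

variable {G : Plant A Q} {Qm : Fin M → Set Q} {N : Fin M → ℕ} {K L L' : Set (Str A)}
  {Z : Type*} {z : Str A → Z}

theorem Saturated.refl (z : Str A → Z) (K : Set (Str A)) : Saturated z K K :=
  ⟨subset_rfl, fun _ h => h.1⟩

theorem saturation_subset (hL : Saturated z K L) (h : L' ⊆ L) : saturation z K L' ⊆ L :=
  fun _ hs => hL.2 ⟨hs.1, fun u hu =>
    let ⟨u', h1, h2⟩ := hs.2 u hu
    ⟨u', pre_mono h h1, h2⟩⟩

theorem equiv_of_mem_pre_saturation {s : Str A} (h : s ∈ pre (saturation z K L)) :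
    ∃ s' ∈ pre L, z s = z s' :=
  let ⟨_, ht⟩ := h
  ht.2 s (List.prefix_append _ _)

/-- Prefixes inside `s` are allowed by assumption; a longer prefix `s ++ w` is equivalent to `s' ++
w`, a prefix of a string of `L`. -/
theorem Observer.append_mem_saturation (hz : Observer G Qm N K z) (hLK : L ⊆ K) {s s' t : Str A}
    (hs : s ∈ pre (saturation z K L)) (hss : z s = z s') (ht : s' ++ t ∈ L) :
    s ++ t ∈ saturation z K L := by
  refine ⟨hz.mem (hz.append hss.symm t) (hLK ht), fun u hu => ?_⟩
  rcases List.prefix_or_prefix_of_prefix hu (List.prefix_append s t) with h | ⟨w, rfl⟩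
  · exact equiv_of_mem_pre_saturation (mem_pre_of_prefix h hs)
  · rw [List.prefix_append_right_inj] at hu
    refine ⟨s' ++ w, ?_, hz.append hss w⟩
    exact mem_pre_of_prefix ((List.prefix_append_right_inj s').mpr hu) (subset_pre L ht)

theorem Observer.controllable_saturation (hz : Observer G Qm N K z) (hLK : L ⊆ K)
    (hL : Controllable G L) : Controllable G (saturation z K L) := by
  intro s hs
  obtain ⟨s', hs', hss⟩ := equiv_of_mem_pre_saturation hs
  have hrun : elig G.closedBehavior s = elig G.closedBehavior s' := by
    ext σ
    change (∃ q, G.run G.init (s ++ [σ]) = some q) ↔ (∃ q, G.run G.init (s' ++ [σ]) = some q)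
    rw [hz.run (hz.append hss [σ])]
  rw [hrun]
  refine control_mono ?_ (hL s' hs')
  rintro σ ⟨t, ht⟩
  refine ⟨t, ?_⟩
  rw [List.append_assoc] at ht ⊢
  exact hz.append_mem_saturation hLK hs hss ht

/-- For the bound, `s ++ t` is equivalent to a prefix of `L`, so its counter with respect to the
original `K_i` is at most `N i`. A hit of `K_i` strictly between would already lie in the
saturation, as its prefixes are prefixes of `s ++ t`; so no reset occurs and the counter includes
all ticks of `t`. -/
theorem Observer.completable_saturation (hz : Observer G Qm N K z) (hLK : L ⊆ K) {i : Fin M}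
    (hL : Completable G (Qm i) (N i) L) :
    Completable G (Qm i) (N i) (saturation z K L) := by
  intro s hs
  refine ⟨?_, ?_⟩
  · obtain ⟨s', hs', hss⟩ := equiv_of_mem_pre_saturation hs
    obtain ⟨t, ht⟩ := hL.exists_hit hs'
    refine firstHits_nonempty (t := t) (mem_part_congr (fun h => ?_)
      (hz.run (hz.append hss.symm t)) ht)
    exact hz.append_mem_saturation hLK hs hss h
  · rintro t ⟨ht, hfirst⟩
    obtain ⟨u, hu, hzu⟩ := ht.1.2 _ List.prefix_rfl
    have hle := hz.counter hzu.symm i (hL.counter_le hLK hu)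
    rw [counter_append] at hle
    · omega
    · refine fun t' h1 h2 h3 => hfirst t' h1 h2 ⟨⟨h3.1, fun u hu => ?_⟩, h3.2⟩
      exact ht.1.2 u (hu.trans ((List.prefix_append_right_inj s).mpr h1))

theorem Observer.saturated_supC (hz : Observer G Qm N K z) (hL : Saturated z K L) :
    Saturated z K (supC G L) :=
  have h := (supC_subset G L).trans hL.1
  ⟨h, subset_supC (saturation_subset hL (supC_subset G L))
    (hz.controllable_saturation h (controllable_supC G L))⟩

theorem Observer.saturated_supBTC (hz : Observer G Qm N K z) (hL : Saturated z K L) (i : Fin M) :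
    Saturated z K (supBTC G (Qm i) (N i) L) :=
  have h := (supBTC_subset G (Qm i) (N i) L).trans hL.1
  ⟨h, subset_supBTC (saturation_subset hL (supBTC_subset G (Qm i) (N i) L))
    (hz.completable_saturation h (completable_supBTC G (Qm i) (N i) L))⟩

/-- The number of classes that meet the prefix closure of `L`. -/
noncomputable def classCount (z : Str A → Z) (L : Set (Str A)) : ℕ := (z '' pre L).ncard

theorem Observer.classCount_lt (hz : Observer G Qm N K z) (hL : L ⊆ K) (hL' : Saturated z K L')
    (h : L' ⊂ L) : classCount z L' < classCount z L := by
  refine Set.ncard_lt_ncard ⟨Set.image_mono (pre_mono h.1), fun hle => h.2 ?_⟩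
    (hz.finite.subset (Set.image_subset_range _ _))
  refine fun s hs => hL'.2 ⟨hL hs, fun u hu => ?_⟩
  obtain ⟨u', h1, h2⟩ := hle ⟨u, mem_pre_of_prefix hu (subset_pre L hs), rfl⟩
  exact ⟨u', h1, h2.symm⟩

theorem Observer.append_mem (hz : Observer G Qm N K z) (hL : Saturated z K L) {s s' t : Str A}
    (hss : z s = z s') (hs' : s' ∈ pre L) (h : s ++ t ∈ L) : s' ++ t ∈ L := by
  have h1 : L ⊆ saturation z K L := fun w hw =>
    ⟨hL.1 hw, fun u hu => ⟨u, mem_pre_of_prefix hu (subset_pre L hw), rfl⟩⟩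
  exact hL.2 (hz.append_mem_saturation hL.1 (pre_mono h1 hs') hss.symm h)

theorem Observer.finite_range_prod (hz : Observer G Qm N K z) (p : Str A → Prop) :
    (Set.range fun s => (z s, p s)).Finite := by
  refine (hz.finite.prod (Set.finite_univ (α := Prop))).subset ?_
  rintro _ ⟨s, rfl⟩
  exact ⟨⟨s, rfl⟩, trivial⟩

theorem Observer.exists_automaton (hz : Observer G Qm N K z) (hL : Saturated z K L) :
    ∃ (n : ℕ) (B : TickAutomaton A (Fin n)), B.markedBehavior = L := by
  -- The class alone does not decide membership in `pre L`: an equivalent string may have passed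
  -- through a forbidden class. Hence the extra bit.
  refine TickAutomaton.exists_markedBehavior_eq L _ (hz.finite_range_prod (· ∈ pre L)) ?_
  intro s s' h t hst
  simp only [Prod.mk.injEq] at h
  exact hz.append_mem hL h.1 (h.2.mp ⟨t, hst⟩) hst

theorem Observer.exists_automaton_part (hz : Observer G Qm N K z) (hL : Saturated z K L)
    (P : Set Q) :
    ∃ (n : ℕ) (B : TickAutomaton A (Fin n)), B.markedBehavior = part G P L := by
  refine TickAutomaton.exists_markedBehavior_eq _ _ (hz.finite_range_prod (· ∈ pre L)) ?_
  intro s s' h t hst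
  simp only [Prod.mk.injEq] at h
  exact mem_part_congr (hz.append_mem hL h.1 (h.2.mp ⟨t, hst.1⟩)) (hz.run (hz.append h.1 t)) hst

end Observer

/-! ### Invariant, progress and termination of Algorithm 2. -/

section Algorithm

variable {A : Type u} {Q : Type v} {M : ℕ}

/-- The result of applying `sup BTC` successively for the indices below `k`. -/
def iterBTC (G : Plant A Q) (Qm : Fin M → Set Q) (N : Fin M → ℕ) (L : Set (Str A)) (k : ℕ)
    (hk : k ≤ M) : Set (Str A) :=
  Fin.foldl k (fun L i => supBTC G (Qm (i.castLE hk)) (N (i.castLE hk)) L) L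

theorem iterBTC_succ (G : Plant A Q) (Qm : Fin M → Set Q) (N : Fin M → ℕ) (L : Set (Str A))
    (i : Fin M) :
    iterBTC G Qm N L (i + 1) i.2 = supBTC G (Qm i) (N i) (iterBTC G Qm N L i i.2.le) :=
  Fin.foldl_succ_last _ _

/-- The language `L` of a reachable configuration: it is obtained from `K` by forbidding certain
classes and contains `sup CBTC`. -/
structure Admissible (G : Plant A Q) (Qm : Fin M → Set Q) (N : Fin M → ℕ) (K : Set (Str A))
    {Z : Type*} (z : Str A → Z) (L : Set (Str A)) : Prop where
  saturated : Saturated z K L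
  supCBTC_subset : supCBTC G Qm N K ⊆ L

/-- The language `L` obtained from `Kj` after the indices below `k` have been treated. -/
structure Reduced (G : Plant A Q) (Qm : Fin M → Set Q) (N : Fin M → ℕ) (K : Set (Str A))
    {Z : Type*} (z : Str A → Z) (Kj : Set (Str A)) (k : ℕ) (L : Set (Str A)) : Prop where
  start : Admissible G Qm N K z Kj
  current : Admissible G Qm N K z L
  subset : L ⊆ Kj
  eq_iterBTC : ∃ hk : k ≤ M, L = iterBTC G Qm N Kj k hk
  completable : L = Kj → ∀ i : Fin M, (i : ℕ) < k → Completable G (Qm i) (N i) Kj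

/-- The invariant of the algorithm. -/
def Invariant (G : Plant A Q) (Qm : Fin M → Set Q) (N : Fin M → ℕ) (K : Set (Str A))
    {Z : Type*} (z : Str A → Z) : Config A Q M → Prop
  | .start Kj => Admissible G Qm N K z Kj
  | .loop Kj i L => Reduced G Qm N K z Kj i L
  | .search Kj i L _ B ξ F ST => Reduced G Qm N K z Kj i L ∧
      B.markedBehavior = part G (Qm i) L ∧ SearchState B (N i) ξ F {p | p ∈ ST}
  | .control Kj _ B R => Reduced G Qm N K z Kj M B.markedBehavior ∧
      Retains B G (supC G B.markedBehavior) R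
  | .test Kj K' => Admissible G Qm N K z Kj ∧ Admissible G Qm N K z K' ∧ K' ⊆ Kj ∧
      K' = supC G (iterBTC G Qm N Kj M le_rfl) ∧
      (K' = Kj → Controllable G Kj ∧ ∀ i, Completable G (Qm i) (N i) Kj)
  | .done C => C = supCBTC G Qm N K

variable {G : Plant A Q} {Qm : Fin M → Set Q} {N : Fin M → ℕ} {K : Set (Str A)}
  {Z : Type*} {z : Str A → Z}

theorem admissible_self (G : Plant A Q) (Qm : Fin M → Set Q) (N : Fin M → ℕ) (K : Set (Str A))
    (z : Str A → Z) : Admissible G Qm N K z K :=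
  ⟨Saturated.refl z K, (isGreatest_supCBTC G Qm N K).1.1⟩

theorem Reduced.initial {Kj : Set (Str A)} (h : Admissible G Qm N K z Kj) :
    Reduced G Qm N K z Kj 0 Kj :=
  ⟨h, h, subset_rfl, ⟨Nat.zero_le _, rfl⟩, fun _ i hi => absurd hi (Nat.not_lt_zero i)⟩

theorem Reduced.supBTC (hz : Observer G Qm N K z) {Kj L : Set (Str A)} {i : Fin M}
    (h : Reduced G Qm N K z Kj i L) :
    Reduced G Qm N K z Kj (i + 1) (supBTC G (Qm i) (N i) L) := by
  have hsub := supBTC_subset G (Qm i) (N i) L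
  refine ⟨h.start, ⟨hz.saturated_supBTC h.current.saturated i, ?_⟩, hsub.trans h.subset,
    ⟨i.2, ?_⟩, fun he k hk => ?_⟩
  · exact subset_supBTC h.current.supCBTC_subset ((isGreatest_supCBTC G Qm N K).1.2.2 i)
  · obtain ⟨hi, hL⟩ := h.eq_iterBTC
    rw [iterBTC_succ, hL]
  · rcases Nat.lt_succ_iff_lt_or_eq.mp hk with hk | hk
    -- The languages only shrink, so a final result equal to `Kj` forces the intermediate one to
    -- equal `Kj` too.
    · exact h.completable (h.subset.antisymm (he ▸ hsub)) k hk
    · obtain rfl := Fin.ext hk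
      have hc := completable_supBTC G (Qm k) (N k) L
      rwa [he] at hc

theorem supBTC_eq_empty {P : Set Q} {n : ℕ} {L : Set (Str A)} (h : part G P L = ∅) :
    supBTC G P n L = ∅ := by
  refine Set.sUnion_eq_empty.mpr ?_
  rintro L' ⟨hsub, hc⟩
  refine Set.eq_empty_of_forall_notMem fun s hs => ?_
  obtain ⟨t, ht⟩ := hc.exists_hit (subset_pre L' hs)
  exact Set.notMem_empty _ (h ▸ part_mono G P hsub ht)

theorem Invariant.step (hz : Observer G Qm N K z) (hKG : K ⊆ G.markedBehavior)
    {c c' : Config A Q M} (h : Invariant G Qm N K z c) (hs : Step G Qm N c c') :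
    Invariant G Qm N K z c' := by
  cases hs with
  | init Kj => exact Reduced.initial h
  | searchEmpty Kj i L he =>
    have h' := Reduced.supBTC hz h
    rwa [supBTC_eq_empty he] at h'
  | searchStart Kj i L n B hne hB =>
    refine ⟨h, hB, ?_⟩
    simpa using SearchState.initial B (N i)
  | searchPop Kj i L n B ξ F p ST new hnd hnew =>
    obtain ⟨h1, h2, h3⟩ := h
    refine ⟨h1, h2, ?_⟩
    have h4 := h3.pop (p := p) (W' := {r | r ∈ ST}) (V := {r | r ∈ new}) (by simp)
      (fun r hr => by simpa using hr) (fun r hr => List.mem_cons_of_mem _ hr) hnew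
    have h5 : {r | r ∈ new ++ ST} = {r | r ∈ new} ∪ {r | r ∈ ST} := by
      ext r
      simp
    rwa [h5]
  | searchEnd Kj i L n B ξ F =>
    obtain ⟨h1, h2, h3⟩ := h
    have h4 : SearchState B (N i) ξ F ∅ := by simpa using h3
    change Reduced G Qm N K z Kj (i + 1) _
    rw [h4.closedOn_eq h2]
    exact h1.supBTC hz
  | controlStart Kj NK n B hB =>
    subst hB
    exact ⟨h, Retains.univ (supC_subset _ _)
      ((supC_subset _ _).trans (h.current.saturated.1.trans hKG))⟩
  | controlRound Kj n B R hR =>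
    obtain ⟨h1, h2⟩ := h
    exact ⟨h1, h2.scRound (supC_subset _ _)
      ((supC_subset _ _).trans (h1.current.saturated.1.trans hKG)) (controllable_supC _ _)⟩
  | controlEnd Kj n B R hR =>
    obtain ⟨h1, h2⟩ := h
    change _ ∧ _
    rw [markedOn_eq_supC rfl (h1.current.saturated.1.trans hKG) h2 hR]
    have hsub := supC_subset G B.markedBehavior
    refine ⟨h1.start, ⟨hz.saturated_supC h1.current.saturated, ?_⟩, hsub.trans h1.subset, ?_,
      fun he => ⟨?_, fun i => h1.completable (h1.subset.antisymm (he ▸ hsub)) i i.2⟩⟩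
    · exact subset_supC h1.current.supCBTC_subset (isGreatest_supCBTC G Qm N K).1.2.1
    · obtain ⟨_, hL⟩ := h1.eq_iterBTC
      rw [← hL]
    · have hc := controllable_supC G B.markedBehavior
      rwa [he] at hc
  | halt Kj K' he =>
    subst he
    obtain ⟨h1, -, -, -, h2⟩ := h
    exact ((isGreatest_supCBTC G Qm N K).2 ⟨h1.saturated.1, h2 rfl⟩).antisymm h1.supCBTC_subset
  | again Kj K' he => exact h.2.1

theorem Invariant.reachable (hz : Observer G Qm N K z) (hKG : K ⊆ G.markedBehavior)
    {c : Config A Q M} (h : Relation.ReflTransGen (Step G Qm N) (.start K) c) :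
    Invariant G Qm N K z c := by
  induction h with
  | refl => exact admissible_self G Qm N K z
  | tail _ hs ih => exact ih.step hz hKG hs

/-- Progress could fail only where a finite automaton or a finite list of new pairs must be chosen;
saturation provides the former, finiteness of the search space the latter. -/
theorem Invariant.exists_step [Finite Q] (hz : Observer G Qm N K z) {c : Config A Q M}
    (h : Invariant G Qm N K z c) (hc : ∀ C, c ≠ .done C) : ∃ c', Step G Qm N c c' := by
  match c, h with
  | .start Kj, _ => exact ⟨_, .init Kj⟩
  | .loop Kj k L, h =>
    obtain ⟨hk, -⟩ := h.eq_iterBTC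
    rcases hk.eq_or_lt with rfl | hk
    · obtain ⟨n, B, hB⟩ := hz.exists_automaton h.current.saturated
      exact ⟨_, .controlStart Kj L n B hB⟩
    · by_cases he : part G (Qm ⟨k, hk⟩) L = ∅
      · exact ⟨_, .searchEmpty Kj ⟨k, hk⟩ L he⟩
      · obtain ⟨n, B, hB⟩ := hz.exists_automaton_part h.current.saturated (Qm ⟨k, hk⟩)
        exact ⟨_, .searchStart Kj ⟨k, hk⟩ L n B he hB⟩
  | .search Kj i L n B ξ F [], _ => exact ⟨_, .searchEnd Kj i L n B ξ F⟩
  | .search Kj i L n B ξ F (p :: ST), _ =>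
    have hfin : {r | r ∉ F ∧ ∃ τ ∈ newTrans B (N i) p, τ.2.2 = r}.Finite :=
      (finite_searchSpace B (N i)).subset fun r hr => by
        obtain ⟨-, τ, hτ, rfl⟩ := hr
        exact newTrans_target_mem hτ
    exact ⟨_, .searchPop Kj i L n B ξ F p ST hfin.toFinset.toList (Finset.nodup_toList _)
      fun r => by simp⟩
  | .control Kj n B R, _ =>
    by_cases hR : scRound B G R = R
    · exact ⟨_, .controlEnd Kj n B R hR⟩
    · exact ⟨_, .controlRound Kj n B R hR⟩
  | .test Kj K', _ =>
    by_cases he : K' = Kj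
    · exact ⟨_, .halt Kj K' he⟩
    · exact ⟨_, .again Kj K' he⟩
  | .done C, _ => exact absurd rfl (hc C)

/-- A measure that decreases in every step: it consists of the number of classes met by `K^j`, the
position within the iteration, and the work left at this position. -/
noncomputable def stepMeasure (N : Fin M → ℕ) (z : Str A → Z) : Config A Q M → ℕ ×ₗ ℕ ×ₗ ℕ
  | .start Kj => toLex (classCount z Kj, toLex (2 * M + 4, 0))
  | .loop Kj i _ => toLex (classCount z Kj, toLex (2 * (M - i) + 3, 0))
  | .search Kj i _ _ B _ F ST => toLex (classCount z Kj,
      toLex (2 * (M - i) + 2, (searchSpace B (N i) \ F).ncard + ST.length))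
  | .control Kj _ _ R => toLex (classCount z Kj, toLex (2, R.ncard))
  | .test Kj _ => toLex (classCount z Kj, toLex (1, 0))
  | .done _ => toLex (0, toLex (0, 0))

theorem lex_lt_of_snd {a b b' c c' : ℕ} (h : b' < b) :
    (toLex (a, toLex (b', c')) : ℕ ×ₗ ℕ ×ₗ ℕ) < toLex (a, toLex (b, c)) :=
  Prod.Lex.toLex_lt_toLex.mpr (Or.inr ⟨rfl, Prod.Lex.toLex_lt_toLex.mpr (Or.inl h)⟩)

theorem lex_lt_of_thd {a b c c' : ℕ} (h : c' < c) :
    (toLex (a, toLex (b, c')) : ℕ ×ₗ ℕ ×ₗ ℕ) < toLex (a, toLex (b, c)) :=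
  Prod.Lex.toLex_lt_toLex.mpr (Or.inr ⟨rfl, Prod.Lex.toLex_lt_toLex.mpr (Or.inr ⟨rfl, h⟩)⟩)

theorem Invariant.stepMeasure_lt [Finite Q] (hz : Observer G Qm N K z) {c c' : Config A Q M}
    (h : Invariant G Qm N K z c) (hs : Step G Qm N c c') :
    stepMeasure N z c' < stepMeasure N z c := by
  cases hs with
  | init Kj => exact lex_lt_of_snd (by omega)
  | searchEmpty Kj i L he => exact lex_lt_of_snd (by omega)
  | searchStart Kj i L n B hne hB => exact lex_lt_of_snd (by omega)
  | searchPop Kj i L n B ξ F p ST new hnd hnew =>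
    -- Each new pair moves from the unvisited part of the search space to the stack, leaving the sum
    -- unchanged; the popped pair lowers it by one.
    refine lex_lt_of_thd ?_
    have hfin := finite_searchSpace B (N i)
    have hV : {r | r ∈ new} ⊆ searchSpace B (N i) \ F := by
      intro r hr
      obtain ⟨hF, τ, hτ, rfl⟩ := (hnew r).mp hr
      exact ⟨newTrans_target_mem hτ, hF⟩
    have hcard : {r | r ∈ new}.ncard = new.length := by
      classical
      rw [← List.toFinset_card_of_nodup hnd, ← Set.ncard_coe_finset]
      congr 1
      ext r
      simp
    have hle := Set.ncard_le_ncard hV hfin.sdiff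
    have hdiff := Set.ncard_sdiff hV (hfin.sdiff.subset hV)
    rw [Set.sdiff_sdiff] at hdiff
    simp only [List.length_append, List.length_cons]
    omega
  | searchEnd Kj i L n B ξ F => exact lex_lt_of_snd (by omega)
  | controlStart Kj NK n B hB => exact lex_lt_of_snd (by omega)
  | controlRound Kj n B R hR =>
    exact lex_lt_of_thd (Set.ncard_lt_ncard
      ((scRound_subset B G R).ssubset_of_ne hR) (Set.toFinite R))
  | controlEnd Kj n B R hR => exact lex_lt_of_snd (by omega)
  | halt Kj K' he =>
    refine lt_of_le_of_lt ?_ (lex_lt_of_snd (b' := 0) (c' := 0) Nat.one_pos)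
    exact Prod.Lex.toLex_mono (Prod.mk_le_mk.mpr ⟨Nat.zero_le _, le_rfl⟩)
  | again Kj K' he =>
    -- The position jumps back up here, so the first component must drop; it does because `K'` is
    -- saturated and strictly smaller than `Kj`.
    obtain ⟨h1, h2, h3, -⟩ := h
    exact Prod.Lex.toLex_lt_toLex.mpr
      (Or.inl (hz.classCount_lt h1.saturated.1 h2.saturated (h3.ssubset_of_ne he)))

end Algorithm

end TDES

theorem mainTheorem3 {A : Type*} {Q : Type*} [Finite A] [Finite Q] (G : TDES.Plant A Q)
    (E : Set (TDES.Str A)) (K : Set (TDES.Str A)) (hKE : K = E ∩ G.markedBehavior)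
    (hK : Language.IsRegular (T := TDES.Event A) K)
    {M : ℕ} (Qm : Fin M → Set Q) (hne : ∀ i, (Qm i).Nonempty) (hcover : ⋃ i, Qm i = G.marked)
    (N : Fin M → ℕ) (hN : ∀ i, 0 < N i) :
    -- the supremum is itself controllable and bounded-time completable, i.e. a greatest element
    IsGreatest (TDES.CBTC G Qm N K) (TDES.supCBTC G Qm N K) ∧
    -- the algorithm has no infinite run
    (¬ ∃ c : ℕ → TDES.Config A Q M, c 0 = .start K ∧ ∀ k, TDES.Step G Qm N (c k) (c (k + 1))) ∧
    -- it can only stop with output `sup CBTC`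
    (∀ c, Relation.ReflTransGen (TDES.Step G Qm N) (.start K) c →
      (¬ ∃ c', TDES.Step G Qm N c c') → c = .done (TDES.supCBTC G Qm N K)) ∧
    -- each iteration computes `sup C` of the iterated `sup BTC` of the current language
    (∀ Kj K', Relation.ReflTransGen (TDES.Step G Qm N) (.start K) (.test Kj K') →
      K' = TDES.supC G (Fin.foldl M (fun L i => TDES.supBTC G (Qm i) (N i) L) Kj)) := by
  obtain ⟨Z, z, hz⟩ := TDES.exists_observer G Qm N K hK
  have hKG : K ⊆ G.markedBehavior := hKE ▸ Set.inter_subset_right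
  refine ⟨TDES.isGreatest_supCBTC G Qm N K, ?_, ?_, ?_⟩
  · rintro ⟨c, h0, hs⟩
    have hinv : ∀ k, TDES.Invariant G Qm N K z (c k) := by
      intro k
      induction k with
      | zero => exact h0 ▸ TDES.admissible_self G Qm N K z
      | succ k ih => exact ih.step hz hKG (hs k)
    exact not_strictAnti_of_wellFoundedLT (fun k => TDES.stepMeasure N z (c k))
      (strictAnti_nat_of_succ_lt fun k => (hinv k).stepMeasure_lt hz (hs k))
  · intro c hc hstuck
    have hinv := TDES.Invariant.reachable hz hKG hc
    by_contra hne
    refine hstuck (hinv.exists_step hz fun C hC => hne ?_)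
    subst hC
    exact congrArg _ hinv
  · intro Kj K' hc
    exact (TDES.Invariant.reachable hz hKG hc).2.2.2.1
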